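/- Let $G$ be a group with a left-order $\le$, that is, a linear order such that $a\le b$ implies $ca\le cb$ for all $a,b,c\in G$. A pair $(C',C)$ of convex subgroups of $G$ is a convex jump if $C'\subsetneq C$ and no convex subgroup lies strictly between $C'$ and $C$. The left-order $\le$ is called Conradian if for every convex jump $(C',C)$ the subgroup $C'$ is normal in $C$ and $C/C'$ is archimedean with respect to its canonical order, whose positive cone is $\{aC' \mid a\in C,\ e\le a\}$; here an ordered group is archimedean if for all $a,b$ with $e<b$ there is $n\in\mathbb N$ with $a<b^n$. Let $F$ be a skew field. A crossed product $F[G,\eta,\alpha]$ of $G$ over $F$ is a ring $S$ that is a free left $F$-module (with the same addition) with a basis $(x_g)_{g\in G}$, together with maps $\eta:G\times G\to F^\times$ and $\alpha:G\to\operatorname{Aut}F$, $g\mapsto\alpha_g$, such that $1x_e$ is the unit element of $S$, $ax_e\cdot bx_e=abx_e$, $ax_e\cdot x_g=ax_g$, $x_g\cdot x_h=\eta(g,h)x_{gh}$ and $x_g\cdot ax_e=\alpha_g(a)x_g$ for all $a,b\in F$ and $g,h\in G$. Proposition. If $G$ possesses a Conradian left-order $\le$ such that the set of convex subgroups of $G$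 with respect to $\le$ is well-ordered by inclusion, then every crossed product $R=F[G,\eta,\alpha]$ of $G$ over a skew field $F$ is a (left and right) Ore domain, that is, $R\neq 0$ has no zero-divisors, and $Ra\cap Rb\neq 0$ and $aR\cap bR\neq 0$ for all non-zero $a,b\in R$. -/

import Mathlib

namespace ConradOre

/-- The set of convex subgroups of an ordered group; as a subtype of `Subgroup G` it is ordered by
inclusion. -/
abbrev ConvexSubgroup (G : Type*) [Group G] [LinearOrder G] : Type _ :=
  {C : Subgroup G // (C : Set G).OrdConnected}

/-- The canonical order of the factor group `H ⧸ N`: its positive cone is the image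
`{aN | 1 ≤ a}` of the positive cone of `H`, and `x ≤ y` means that `x⁻¹ y` lies in this cone. -/
def canonicalLE {H : Type*} [Group H] [LE H] (N : Subgroup H) [N.Normal] (x y : H ⧸ N) : Prop :=
  x⁻¹ * y ∈ (fun a : H => (a : H ⧸ N)) '' {a : H | 1 ≤ a}

/-- A left-order `le` of a group is archimedean if for all `a` and all `b > 1` there is a natural
number `n` with `a < b ^ n`; the strict relation `x < y` is `le x y ∧ x ≠ y`. -/
def IsArchimedeanOrder {H : Type*} [Group H] (le : H → H → Prop) : Prop :=
  ∀ a b : H, (le 1 b ∧ 1 ≠ b) → ∃ n : ℕ, le a (b ^ n) ∧ a ≠ b ^ n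

/-- The order of `G` is Conradian: for each convex jump `(C', C)` (i.e. `C' ⋖ C` among the convex
subgroups), `C'` is normal in `C` and `C / C'` is archimedean for its canonical order. -/
def IsConradian (G : Type*) [Group G] [LinearOrder G] : Prop :=
  ∀ C' C : ConvexSubgroup G, C' ⋖ C →
    ∃ _ : (C'.1.subgroupOf C.1).Normal,
      IsArchimedeanOrder (canonicalLE (C'.1.subgroupOf C.1))

/-- `S` is a crossed product of the group `G` over the ring `R`: the ring `S` is a free left
`R`-module with basis `x_g` (`g ∈ G`), with maps `η : G × G → Rˣ` and `α : G → Aut R` that satisfy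
the five rules below. The ring `R` is contained in `S` through `a ↦ a x_e`. -/
structure CrossedProduct (R G S : Type*) [Ring R] [Group G] [Ring S] [Module R S] where
  /-- the basis `X_G` -/
  x : Module.Basis G R S
  /-- the twisting -/
  η : G → G → Rˣ
  /-- the action -/
  α : G → (R ≃+* R)
  one_smul_x_one : (1 : R) • x 1 = 1
  coeff_mul_coeff (a b : R) : (a • x 1) * (b • x 1) = (a * b) • x 1
  coeff_mul_x (a : R) (g : G) : (a • x 1) * ((1 : R) • x g) = a • x g
  x_mul_x (g h : G) : ((1 : R) • x g) * ((1 : R) • x h) = (η g h : R) • x (g * h)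
  x_mul_coeff (g : G) (a : R) : ((1 : R) • x g) * (a • x 1) = α g a • x g

/-- A (left and right) Ore domain: an integral domain, not necessarily commutative, in which
`Ra ∩ Rb ≠ 0` and `aR ∩ bR ≠ 0` for all non-zero `a`, `b`. -/
structure IsOreDomain (R : Type*) [Ring R] : Prop where
  isDomain : IsDomain R
  left_ore : ∀ a b : R, a ≠ 0 → b ≠ 0 → ∃ c d : R, c * a = d * b ∧ c * a ≠ 0
  right_ore : ∀ a b : R, a ≠ 0 → b ≠ 0 → ∃ c d : R, a * c = b * d ∧ a * c ≠ 0

end ConradOre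

/-!
By Hölder's theorem the factor `C / C'` of a convex jump is abelian. For a convex subgroup `C` let
`S_C` be the subring of the elements with support in `C`. Transfinite induction on `C` shows that
`S_C` is left Ore. If `C` is a limit, any two elements of `S_C` lie in `S_D` for some `D < C`. At a
jump `(C', C)`, units `e_q` of degrees `q ∈ C / C'` form a basis of `S_C` over `S_{C'}`, and ranks
over the Ore domain `S_{C'}` behave as over a field. If `a` and `b` had no common left multiple,
the products `e_q a` and `e_q b` with `q ∈ U` would thus require `2|U| ≤ |UT|` for all finite sets
`U`, where `T` is the set of degrees of `a` and `b`; this contradicts the polynomial growth of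
finitely generated abelian groups.

The opposite ring, graded through `g ↦ g⁻¹`, gives the right Ore condition. The order of `G` has the
unique product property, which excludes zero divisors.
-/

namespace ConradOre

section Hoelder

variable {Q : Type*} [Group Q] [LinearOrder Q]

theorem IsArchimedeanOrder.exists_lt_pow (h : IsArchimedeanOrder (H := Q) (· ≤ ·)) (a : Q) {b : Q}
    (hb : 1 < b) : ∃ n : ℕ, a < b ^ n := by
  obtain ⟨n, hle, hne⟩ := h a b ⟨hb.le, hb.ne⟩
  exact ⟨n, hle.lt_of_ne hne⟩

theorem IsArchimedeanOrder.exists_pow_le_lt_pow_succ (h : IsArchimedeanOrder (H := Q) (· ≤ ·))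
    {a d : Q} (hd : 1 < d) (ha : 1 ≤ a) : ∃ n : ℕ, d ^ n ≤ a ∧ a < d ^ (n + 1) := by
  classical
  have hex := h.exists_lt_pow a hd
  have hpos : Nat.find hex ≠ 0 := by
    rw [Ne, Nat.find_eq_zero, pow_zero]
    exact ha.not_gt
  obtain ⟨n, hn⟩ := Nat.exists_eq_add_one_of_ne_zero hpos
  have hlt := Nat.find_spec hex
  rw [hn] at hlt
  exact ⟨n, not_lt.1 (Nat.find_min hex (by omega)), hlt⟩

variable [MulLeftMono Q]

theorem IsArchimedeanOrder.lt_mul_of_one_lt (h : IsArchimedeanOrder (H := Q) (· ≤ ·)) {p g : Q}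
    (hp : 1 < p) (hg : 1 < g) : g < p * g := by
  by_contra! hle
  have pow_mul_le (n : ℕ) : p ^ n * g ≤ g := by
    induction n with
    | zero => simp
    | succ n ih =>
      calc p ^ (n + 1) * g = p ^ n * (p * g) := by rw [pow_succ, mul_assoc]
        _ ≤ p ^ n * g := by gcongr
        _ ≤ g := ih
  obtain ⟨n, hn⟩ := h.exists_lt_pow g hp
  exact ((lt_mul_of_one_lt_right' (p ^ n) hg).trans_le (pow_mul_le n)).not_gt hn

theorem IsArchimedeanOrder.one_lt_inv_mul_mul (h : IsArchimedeanOrder (H := Q) (· ≤ ·)) {p : Q}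
    (hp : 1 < p) (g : Q) : 1 < g⁻¹ * p * g := by
  have conj_of_one_lt {p g : Q} (hp : 1 < p) (hg : 1 < g) : 1 < g⁻¹ * p * g := by
    rw [mul_assoc, lt_inv_mul_iff_mul_lt, mul_one]
    exact h.lt_mul_of_one_lt hp hg
  rcases lt_trichotomy g 1 with hg | rfl | hg
  · by_contra! hle
    have hne : g⁻¹ * p * g ≠ 1 := fun h1 ↦ hp.ne' (by simpa [mul_assoc, inv_mul_eq_one] using h1)
    have hlt := conj_of_one_lt (Left.one_lt_inv_iff.2 (hle.lt_of_ne hne)) (Left.one_lt_inv_iff.2 hg)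
    have heq : g⁻¹⁻¹ * (g⁻¹ * p * g)⁻¹ * g⁻¹ = p⁻¹ := by group
    rw [heq, Left.one_lt_inv_iff] at hlt
    exact hlt.not_gt hp
  · simpa using hp
  · exact conj_of_one_lt hp hg

theorem IsArchimedeanOrder.mulRightMono (h : IsArchimedeanOrder (H := Q) (· ≤ ·)) :
    MulRightMono Q := by
  refine ⟨fun c a b hab ↦ ?_⟩
  change a * c ≤ b * c
  rcases hab.eq_or_lt with rfl | hlt
  · exact le_rfl
  have hconj := (h.one_lt_inv_mul_mul (lt_inv_mul_iff_lt.2 hlt) c).le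
  calc
    a * c ≤ a * c * (c⁻¹ * (a⁻¹ * b) * c) := le_mul_of_one_le_right' hconj
    _ = b * c := by group

theorem IsArchimedeanOrder.exists_pow_eq_of_isLeast (h : IsArchimedeanOrder (H := Q) (· ≤ ·))
    {e a : Q} (he : IsLeast (Set.Ioi 1) e) (ha : 1 ≤ a) : ∃ n : ℕ, e ^ n = a := by
  obtain ⟨n, hle, hlt⟩ := h.exists_pow_le_lt_pow_succ he.1 ha
  refine ⟨n, hle.eq_of_not_lt fun hlt' ↦ hlt.not_ge ?_⟩
  rw [pow_succ, ← le_inv_mul_iff_mul_le]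
  exact he.2 (lt_inv_mul_iff_lt.2 hlt')

theorem exists_one_lt_mul_self_le [MulRightMono Q] {p ε : Q} (hp : 1 < p) (hpε : p < ε) :
    ∃ d : Q, 1 < d ∧ d * d ≤ ε := by
  rcases le_or_gt (p * p) ε with hle | hgt
  · exact ⟨p, hp, hle⟩
  · refine ⟨p⁻¹ * ε, lt_inv_mul_iff_lt.2 hpε, ?_⟩
    calc p⁻¹ * ε * (p⁻¹ * ε) ≤ p * (p⁻¹ * ε) := by
          gcongr
          exact (inv_mul_lt_iff_lt_mul.2 hgt).le
      _ = ε := mul_inv_cancel_left p ε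

/- Otherwise `ε = (ba)⁻¹ab > 1` dominates some `d ^ 2` with `d > 1`. If `d ^ n ≤ a < d ^ (n + 1)`
and `d ^ m ≤ b < d ^ (m + 1)`, then `ab < d ^ (n + m + 2) ≤ baε = ab`. -/
theorem IsArchimedeanOrder.mul_le_mul_swap (h : IsArchimedeanOrder (H := Q) (· ≤ ·))
    (hleast : ¬∃ e : Q, IsLeast (Set.Ioi 1) e) {a b : Q} (ha : 1 ≤ a) (hb : 1 ≤ b) :
    a * b ≤ b * a := by
  have := h.mulRightMono
  by_contra! hlt
  have hε : 1 < (b * a)⁻¹ * (a * b) := lt_inv_mul_iff_lt.2 hlt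
  obtain ⟨p, hp, hpε⟩ : ∃ p, 1 < p ∧ p < (b * a)⁻¹ * (a * b) := by
    by_contra! hmin
    exact hleast ⟨_, hε, hmin⟩
  obtain ⟨d, hd, hdd⟩ := exists_one_lt_mul_self_le hp hpε
  obtain ⟨n, hna, han⟩ := h.exists_pow_le_lt_pow_succ hd ha
  obtain ⟨m, hmb, hbm⟩ := h.exists_pow_le_lt_pow_succ hd hb
  have hle : d ^ (n + 1) * d ^ (m + 1) ≤ a * b := by
    calc d ^ (n + 1) * d ^ (m + 1) = d ^ m * d ^ n * (d * d) := by
          rw [← pow_two, ← pow_add, ← pow_add, ← pow_add]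
          congr 1
          omega
      _ ≤ b * a * ((b * a)⁻¹ * (a * b)) := by gcongr
      _ = a * b := mul_inv_cancel_left _ _
  exact hle.not_gt (Right.mul_lt_mul han hbm)

theorem IsArchimedeanOrder.commute (h : IsArchimedeanOrder (H := Q) (· ≤ ·)) (a b : Q) :
    Commute a b := by
  have commute_of_one_le {a b : Q} (ha : 1 ≤ a) (hb : 1 ≤ b) : Commute a b := by
    by_cases hleast : ∃ e : Q, IsLeast (Set.Ioi 1) e
    · obtain ⟨e, he⟩ := hleast
      obtain ⟨n, rfl⟩ := h.exists_pow_eq_of_isLeast he ha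
      obtain ⟨m, rfl⟩ := h.exists_pow_eq_of_isLeast he hb
      exact Commute.pow_pow_self e n m
    · exact (h.mul_le_mul_swap hleast ha hb).antisymm (h.mul_le_mul_swap hleast hb ha)
  have commute_of_one_le_left {a : Q} (ha : 1 ≤ a) : Commute a b := by
    rcases le_total 1 b with hb | hb
    · exact commute_of_one_le ha hb
    · exact Commute.inv_right_iff.1 (commute_of_one_le ha (Left.one_le_inv_iff.2 hb))
  rcases le_total 1 a with ha | ha
  · exact commute_of_one_le_left ha
  · exact Commute.inv_left_iff.1 (commute_of_one_le_left (Left.one_le_inv_iff.2 ha))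

end Hoelder

section QuotientOrder

variable {H : Type*} [Group H] [LinearOrder H] [MulLeftMono H]

/-- The canonical order of the factor group `H ⧸ N` by a convex normal subgroup, as a linear
order. It is not an instance because it depends on the convexity of `N`. -/
noncomputable abbrev quotientLinearOrder (N : Subgroup H) [N.Normal]
    (hN : (N : Set H).OrdConnected) : LinearOrder (H ⧸ N) where
  le := canonicalLE N
  le_refl x := ⟨1, le_refl (1 : H), by simp⟩
  le_trans x y z := by
    rintro ⟨a, ha, hxy : (a : H ⧸ N) = x⁻¹ * y⟩ ⟨b, hb, hyz : (b : H ⧸ N) = y⁻¹ * z⟩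
    refine ⟨a * b, one_le_mul ha hb, ?_⟩
    change ((a * b : H) : H ⧸ N) = x⁻¹ * z
    rw [QuotientGroup.mk_mul, hxy, hyz]
    group
  le_antisymm x y := by
    rintro ⟨a, ha, hxy : (a : H ⧸ N) = x⁻¹ * y⟩ ⟨b, hb, hyx : (b : H ⧸ N) = y⁻¹ * x⟩
    have hab : a * b ∈ N := by
      rw [← QuotientGroup.eq_one_iff, QuotientGroup.mk_mul, hxy, hyx]
      group
    have haN : a ∈ N := hN.out N.one_mem hab ⟨ha, le_mul_of_one_le_right' hb⟩
    rw [(QuotientGroup.eq_one_iff a).2 haN] at hxy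
    exact inv_mul_eq_one.1 hxy.symm
  le_total x y := by
    obtain ⟨a, ha⟩ := QuotientGroup.mk_surjective (x⁻¹ * y)
    rcases le_total 1 a with h | h
    · exact Or.inl ⟨a, h, ha⟩
    · refine Or.inr ⟨a⁻¹, Left.one_le_inv_iff.2 h, ?_⟩
      change ((a⁻¹ : H) : H ⧸ N) = y⁻¹ * x
      rw [QuotientGroup.mk_inv, ha]
      group
  toDecidableLE := Classical.decRel _

theorem commute_quotient_of_isArchimedeanOrder {N : Subgroup H} [N.Normal]
    (hN : (N : Set H).OrdConnected) (h : IsArchimedeanOrder (canonicalLE N)) (a b : H ⧸ N) :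
    Commute a b := by
  let := quotientLinearOrder N hN
  have : MulLeftMono (H ⧸ N) := by
    refine ⟨fun c x y hxy ↦ ?_⟩
    change canonicalLE N x y at hxy
    change canonicalLE N (c * x) (c * y)
    simpa only [canonicalLE, mul_inv_rev, mul_assoc, inv_mul_cancel_left] using hxy
  exact IsArchimedeanOrder.commute h a b

end QuotientOrder

section Growth

open Finset
open scoped Pointwise

variable {Q : Type*} [CommMonoid Q] [DecidableEq Q]

theorem card_pow_le_succ_pow_card (T : Finset Q) (n : ℕ) : #(T ^ n) ≤ (n + 1) ^ #T := by
  have hsub : T ^ n ⊆ univ.image fun f : T → Fin (n + 1) ↦ ∏ t : T, (t : Q) ^ (f t : ℕ) := by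
    intro x hx
    obtain ⟨g, hg⟩ := mem_pow.1 hx
    refine mem_image.2 ⟨fun t ↦ Fin.ofNat _ #{i | g i = t}, mem_univ _, ?_⟩
    have hlt (t : T) : #{i | g i = t} < n + 1 :=
      Nat.lt_succ_of_le (by simpa using card_filter_le univ fun i ↦ g i = t)
    calc ∏ t : T, (t : Q) ^ (Fin.ofNat (n + 1) #{i | g i = t} : ℕ)
        = ∏ t : T, ∏ i with g i = t, (g i : Q) := by
          refine prod_congr rfl fun t _ ↦ ?_
          rw [Fin.val_ofNat, Nat.mod_eq_of_lt (hlt t), ← prod_const]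
          exact prod_congr rfl fun i hi ↦ by rw [(mem_filter.1 hi).2]
      _ = ∏ i, (g i : Q) := prod_fiberwise _ _ _
      _ = x := by rw [← hg, List.prod_ofFn]
  calc #(T ^ n) ≤ #(univ : Finset (T → Fin (n + 1))) := (card_le_card hsub).trans card_image_le
    _ = (n + 1) ^ #T := by simp

theorem exists_card_mul_lt (T : Finset Q) {c : ℝ} (hc : 1 < c) :
    ∃ U : Finset Q, (#(U * T) : ℝ) < c * #U := by
  by_contra! hgrowth
  have pow_le_card (n : ℕ) : c ^ n ≤ #(T ^ n) := by
    induction n with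
    | zero => simp
    | succ n ih =>
      calc c ^ (n + 1) = c * c ^ n := pow_succ' c n
        _ ≤ c * #(T ^ n) := by gcongr
        _ ≤ #(T ^ (n + 1)) := by rw [pow_succ]; exact hgrowth _
  have hlim := (tendsto_pow_const_div_const_pow_of_one_lt #T hc).eventually_lt_const
    (inv_pos.2 (zero_lt_one.trans hc))
  obtain ⟨n, hn⟩ := ((Filter.tendsto_add_atTop_nat 1).eventually hlim).exists
  rw [div_lt_iff₀ (by positivity), pow_succ', inv_mul_cancel_left₀ (by positivity)] at hn
  refine hn.not_ge ((pow_le_card n).trans ?_)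
  exact_mod_cast card_pow_le_succ_pow_card T n

end Growth

section LeftOre

/-- The left Ore condition `Ra ∩ Rb ≠ 0` for all non-zero `a` and `b`. -/
def IsLeftOre (R : Type*) [Ring R] : Prop :=
  ∀ a b : R, a ≠ 0 → b ≠ 0 → ∃ c d : R, c * a = d * b ∧ c * a ≠ 0

variable {R : Type*} [Ring R]

theorem isLeftOre_of_not_linearIndependent [NoZeroDivisors R]
    (h : ∀ a b : R, ¬LinearIndependent R ![a, b]) : IsLeftOre R := by
  intro a b ha hb
  have hdep := h a b
  simp only [LinearIndependent.pair_iff, smul_eq_mul, not_forall] at hdep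
  obtain ⟨s, t, hst, hne⟩ := hdep
  have heq : s * a = -t * b := by rwa [neg_mul, ← add_eq_zero_iff_eq_neg]
  refine ⟨s, -t, heq, fun hsa ↦ hne ⟨(mul_eq_zero.1 hsa).resolve_right ha, ?_⟩⟩
  exact neg_eq_zero.1 ((mul_eq_zero.1 (heq ▸ hsa)).resolve_right hb)

theorem IsLeftOre.exists_mul_map_eq_mul_map {A : Type*} [Ring A] (h : IsLeftOre A) {f : A →+* R}
    (hf : Function.Injective f) {a b : A} (ha : f a ≠ 0) (hb : f b ≠ 0) :
    ∃ c d : R, c * f a = d * f b ∧ c * f a ≠ 0 := by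
  obtain ⟨c, d, heq, hne⟩ := h a b (ne_of_apply_ne f (by simpa using ha))
    (ne_of_apply_ne f (by simpa using hb))
  exact ⟨f c, f d, by simpa only [map_mul] using congrArg f heq,
    by simpa only [map_mul] using (map_ne_zero_iff f hf).2 hne⟩

variable {M : Type*} [AddCommGroup M] [Module R M]

theorem linearIndependent_smul_of_ne_zero [NoZeroDivisors R] {ι : Type*} {v : ι → M} {c : ι → R}
    (hv : LinearIndependent R v) (hc : ∀ i, c i ≠ 0) : LinearIndependent R (fun i ↦ c i • v i) := by
  rw [linearIndependent_iff'] at hv ⊢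
  intro s g hg i hi
  simp only [smul_smul] at hg
  exact (mul_eq_zero.1 (hv s _ hg i hi)).resolve_right (hc i)

theorem IsLeftOre.exists_mul_eq_mul [Nontrivial R] (h : IsLeftOre R) (a : R) {b : R}
    (hb : b ≠ 0) : ∃ c d : R, c ≠ 0 ∧ c * a = d * b := by
  by_cases ha : a = 0
  · exact ⟨1, 0, one_ne_zero, by simp [ha]⟩
  · obtain ⟨c, d, heq, hne⟩ := h a b ha hb
    exact ⟨c, d, left_ne_zero_of_mul hne, heq⟩

theorem IsLeftOre.exists_linearIndependent_ker [IsDomain R] (h : IsLeftOre R) (φ : M →ₗ[R] R)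
    {n : ℕ} {v : Fin (n + 1) → M} (hv : LinearIndependent R v) :
    ∃ w : Fin n → LinearMap.ker φ, LinearIndependent R w := by
  suffices ∃ w : Fin n → M, (∀ i, φ (w i) = 0) ∧ LinearIndependent R w by
    obtain ⟨w, hφ, hw⟩ := this
    exact ⟨fun i ↦ ⟨w i, hφ i⟩, LinearIndependent.of_comp (LinearMap.ker φ).subtype hw⟩
  by_cases hφ : ∀ i, φ (v i) = 0
  · exact ⟨v ∘ Fin.castSucc, fun i ↦ hφ _, hv.comp _ (Fin.castSucc_injective n)⟩
  push Not at hφ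
  obtain ⟨j, hj⟩ := hφ
  choose c d hc hcd using fun i ↦ h.exists_mul_eq_mul (φ (v i)) hj
  refine ⟨fun i ↦ c (j.succAbove i) • v (j.succAbove i) - d (j.succAbove i) • v j,
    fun i ↦ by simp [hcd], ?_⟩
  have hscaled : LinearIndependent R fun i ↦ Function.update c j 1 i • v i := by
    refine linearIndependent_smul_of_ne_zero hv fun i ↦ ?_
    rcases eq_or_ne i j with rfl | hij
    · simp
    · simpa [hij] using hc i
  have hsheared := (linearIndependent_add_smul_iff (i := j) (c := Function.update (-d) j 0)
    (by simp)).2 hscaled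
  convert hsheared.comp _ (Fin.succAbove_right_injective (p := j)) using 2 with i
  simp [sub_eq_add_neg]

theorem IsLeftOre.exists_ne_zero_map_eq_zero [IsDomain R] (h : IsLeftOre R) {n : ℕ}
    (φ : Fin n → M →ₗ[R] R) {v : Fin (n + 1) → M} (hv : LinearIndependent R v) :
    ∃ x : M, x ≠ 0 ∧ ∀ i, φ i x = 0 := by
  induction n generalizing M with
  | zero => exact ⟨v 0, hv.ne_zero 0, fun i ↦ i.elim0⟩
  | succ n ih =>
    obtain ⟨w, hw⟩ := h.exists_linearIndependent_ker (φ 0) hv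
    obtain ⟨x, hx, hφx⟩ := ih (fun i ↦ φ i.succ ∘ₗ (LinearMap.ker (φ 0)).subtype) hw
    exact ⟨x, by simpa using hx, Fin.cases x.2 hφx⟩

theorem IsLeftOre.strongRankCondition [IsDomain R] (h : IsLeftOre R) : StrongRankCondition R := by
  refine (strongRankCondition_iff_succ R).2 fun n f hf ↦ ?_
  obtain ⟨x, hx, hfx⟩ := h.exists_ne_zero_map_eq_zero (fun i ↦ LinearMap.proj i ∘ₗ f)
    (Pi.basisFun R (Fin (n + 1))).linearIndependent
  exact hx (hf ((funext hfx).trans (map_zero f).symm))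

open scoped Pointwise in
open Finset in
theorem isLeftOre_of_basis {A S Q : Type*} [Ring A] [StrongRankCondition A] [Ring S]
    [NoZeroDivisors S] [Module A S] [IsScalarTower A S S] [CommMonoid Q] (e : Module.Basis Q A S)
    (he : ∀ (u v : Q) (r : A), e u * r • e v ∈ Submodule.span A {e (u * v)}) : IsLeftOre S := by
  classical
  refine isLeftOre_of_not_linearIndependent fun a b hab ↦ ?_
  set T : Finset Q := (e.repr a).support ∪ (e.repr b).support
  obtain ⟨U, hU⟩ := exists_card_mul_lt T one_lt_two
  have hmem (u : U) {x : S} (hx : (e.repr x).support ⊆ T) :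
      e u * x ∈ Submodule.span A ((U * T).image e : Set S) := by
    rw [← e.linearCombination_repr x, Finsupp.linearCombination_apply, Finsupp.sum, mul_sum]
    refine Submodule.sum_mem _ fun t ht ↦ Submodule.span_mono ?_ (he u t _)
    rw [Set.singleton_subset_iff]
    exact Finset.mem_image_of_mem e (mul_mem_mul u.2 (hx ht))
  have hli : LinearIndependent A fun p : U × Fin 2 ↦ e p.1 • ![a, b] p.2 :=
    linearIndependent_smul (e.linearIndependent.comp _ Subtype.val_injective) hab
  have hcard : Fintype.card (U × Fin 2) ≤ Fintype.card ((U * T).image e : Set S) := by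
    refine linearIndependent_le_span_aux' _ hli _ ?_
    rintro _ ⟨⟨u, i⟩, rfl⟩
    fin_cases i
    · exact hmem u subset_union_left
    · exact hmem u subset_union_right
  have hle : #U * 2 ≤ #(U * T) := by
    simpa using hcard.trans (by simpa using card_image_le)
  exact hU.not_ge (by rw [mul_comm]; exact_mod_cast hle)

end LeftOre

section Support

variable {F G S : Type*} [AddCommGroup F] [AddCommGroup S]

/-- The elements of `S` whose coefficients with respect to `coeff` vanish outside of `X`. -/
def supportedIn (coeff : S ≃+ (G →₀ F)) (X : Set G) : AddSubgroup S where
  carrier := {s | ∀ g ∉ X, coeff s g = 0}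
  zero_mem' g _ := by simp
  add_mem' hs ht g hg := by simp [hs g hg, ht g hg]
  neg_mem' hs g hg := by simp [hs g hg]

variable {coeff : S ≃+ (G →₀ F)} {X Y : Set G} {s : S}

theorem mem_supportedIn : s ∈ supportedIn coeff X ↔ ∀ g ∉ X, coeff s g = 0 := Iff.rfl

theorem mem_supportedIn_iff_support_subset :
    s ∈ supportedIn coeff X ↔ ((coeff s).support : Set G) ⊆ X :=
  forall_congr' fun g ↦ by simp [not_imp_comm]

theorem mem_supportedIn_support (coeff : S ≃+ (G →₀ F)) (s : S) :
    s ∈ supportedIn coeff (coeff s).support :=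
  mem_supportedIn_iff_support_subset.2 subset_rfl

theorem symm_single_mem_supportedIn (g : G) (a : F) :
    coeff.symm (Finsupp.single g a) ∈ supportedIn coeff {g} := by
  intro h hh
  rw [coeff.apply_symm_apply, Finsupp.single_eq_of_ne hh]

theorem supportedIn_mono (hXY : X ⊆ Y) : supportedIn coeff X ≤ supportedIn coeff Y :=
  fun _ hs g hg ↦ hs g (Set.notMem_subset hXY hg)

theorem supportedIn_le_iff {P : AddSubgroup S} :
    supportedIn coeff X ≤ P ↔ ∀ g ∈ X, supportedIn coeff {g} ≤ P := by
  refine ⟨fun h g hg ↦ (supportedIn_mono (by simpa using hg)).trans h, fun h s hs ↦ ?_⟩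
  have hsum : ∑ g ∈ (coeff s).support, coeff.symm (Finsupp.single g (coeff s g)) = s := by
    rw [← map_sum]
    exact coeff.symm_apply_eq.2 (Finsupp.sum_single (coeff s))
  rw [← hsum]
  exact sum_mem fun g hg ↦
    h g (mem_supportedIn_iff_support_subset.1 hs hg) (symm_single_mem_supportedIn g _)

theorem eq_zero_of_mem_supportedIn_of_disjoint (hX : s ∈ supportedIn coeff X)
    (hY : s ∈ supportedIn coeff Y) (hXY : Disjoint X Y) : s = 0 := by
  refine (map_eq_zero_iff coeff coeff.injective).1 (Finsupp.ext fun g ↦ ?_)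
  by_cases hg : g ∈ X
  · exact hY g (Set.disjoint_left.1 hXY hg)
  · exact hX g hg

theorem eq_zero_of_sum_eq_zero_of_pairwise_disjoint {ι : Type*} {X : ι → Set G}
    (hX : Pairwise (Function.onFun Disjoint X)) {t : Finset ι} {f : ι → S}
    (hf : ∀ i ∈ t, f i ∈ supportedIn coeff (X i)) (hsum : ∑ i ∈ t, f i = 0) {i : ι} (hi : i ∈ t) :
    f i = 0 := by
  classical
  have heq : f i = -∑ j ∈ t.erase i, f j := by
    rwa [← add_eq_zero_iff_eq_neg, Finset.add_sum_erase t f hi]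
  have hrest : f i ∈ supportedIn coeff (⋃ j ∈ t.erase i, X j) := by
    rw [heq]
    refine neg_mem (sum_mem fun j hj ↦ ?_)
    exact supportedIn_mono (Set.subset_biUnion_of_mem (u := X) hj)
      (hf j (Finset.mem_of_mem_erase hj))
  refine eq_zero_of_mem_supportedIn_of_disjoint (hf i hi) hrest ?_
  exact Set.disjoint_iUnion₂_right.2 fun j hj ↦ hX (Finset.ne_of_mem_erase hj).symm

theorem exists_sub_mem_supportedIn_diff (hs : s ∈ supportedIn coeff X) (g : G) :
    ∃ c ∈ supportedIn coeff {g}, s - c ∈ supportedIn coeff (X \ {g}) := by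
  refine ⟨_, symm_single_mem_supportedIn g (coeff s g), ?_⟩
  intro h hh
  rw [map_sub, coeff.apply_symm_apply, Finsupp.sub_apply]
  rcases eq_or_ne h g with rfl | hne
  · simp
  · rw [Finsupp.single_eq_of_ne hne, sub_zero]
    exact hs h fun hX ↦ hh ⟨hX, hne⟩

end Support

/-- A ring graded by the group `G`, given by coefficients in `F` for each degree, in which the
non-zero homogeneous elements are invertible. This is the left-right symmetric part of the
structure of a crossed product over a skew field. -/
structure GradedDivisionRing (F G S : Type*) [AddCommGroup F] [Group G] [Ring S] where
  /-- the coefficients of an element -/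
  coeff : S ≃+ (G →₀ F)
  one_mem : 1 ∈ supportedIn coeff {1}
  mul_mem {g h : G} {s t : S} (hs : s ∈ supportedIn coeff {g}) (ht : t ∈ supportedIn coeff {h}) :
    s * t ∈ supportedIn coeff {g * h}
  exists_unit {g : G} {s : S} (hs : s ∈ supportedIn coeff {g}) (hs0 : s ≠ 0) :
    ∃ u : Sˣ, ↑u = s ∧ ↑u⁻¹ ∈ supportedIn coeff {g⁻¹}

namespace GradedDivisionRing

open scoped Pointwise

variable {F G S : Type*} [AddCommGroup F] [Group G] [Ring S]

/-- The opposite ring, graded through `g ↦ g⁻¹`. -/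
noncomputable def op (D : GradedDivisionRing F G S) : GradedDivisionRing F G Sᵐᵒᵖ :=
  have mem_iff (g : G) (s : Sᵐᵒᵖ) :
      s ∈ supportedIn ((MulOpposite.opAddEquiv.symm.trans D.coeff).trans
        (Finsupp.domCongr (Equiv.inv G))) {g} ↔ s.unop ∈ supportedIn D.coeff {g⁻¹} := by
    simp only [mem_supportedIn]
    refine (Equiv.inv G).forall_congr fun h ↦ ?_
    simp [inv_eq_iff_eq_inv]
  { coeff := (MulOpposite.opAddEquiv.symm.trans D.coeff).trans (Finsupp.domCongr (Equiv.inv G))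
    one_mem := by simpa [mem_iff] using D.one_mem
    mul_mem := fun hs ht ↦ by
      rw [mem_iff] at hs ht ⊢
      simpa using D.mul_mem ht hs
    exists_unit := fun {g s} hs hs0 ↦ by
      rw [mem_iff] at hs
      obtain ⟨u, hu, hu'⟩ := D.exists_unit hs (by simpa using hs0)
      exact ⟨Units.opEquiv.symm (MulOpposite.op u), MulOpposite.unop_injective hu,
        (mem_iff _ _).2 hu'⟩ }

variable (D : GradedDivisionRing F G S)

theorem mul_mem_supportedIn {X Y : Set G} {s t : S} (hs : s ∈ supportedIn D.coeff X)
    (ht : t ∈ supportedIn D.coeff Y) : s * t ∈ supportedIn D.coeff (X * Y) := by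
  suffices hX : supportedIn D.coeff X ≤
      (supportedIn D.coeff (X * Y)).comap (AddMonoidHom.mulRight t) from hX hs
  refine supportedIn_le_iff.2 fun g hg s' hs' ↦ ?_
  suffices hY : supportedIn D.coeff Y ≤
      (supportedIn D.coeff (X * Y)).comap (AddMonoidHom.mulLeft s') from hY ht
  refine supportedIn_le_iff.2 fun h hh t' ht' ↦ supportedIn_mono ?_ (D.mul_mem hs' ht')
  simpa using Set.mul_mem_mul hg hh

theorem exists_unit_mem [Nontrivial S] (g : G) :
    ∃ u : Sˣ, ↑u ∈ supportedIn D.coeff {g} ∧ ↑u⁻¹ ∈ supportedIn D.coeff {g⁻¹} := by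
  obtain ⟨s, hs⟩ := exists_ne (0 : S)
  obtain ⟨h, hh⟩ := Finsupp.ne_iff.1 ((map_ne_zero_iff D.coeff D.coeff.injective).2 hs)
  obtain ⟨u, hu, hu'⟩ := D.exists_unit (symm_single_mem_supportedIn g (D.coeff s h))
    (by simpa using hh)
  exact ⟨u, hu ▸ symm_single_mem_supportedIn g _, hu'⟩

theorem exists_unit_sub_mem {s : S} {g : G} (hg : g ∈ (D.coeff s).support) :
    ∃ u : Sˣ, ↑u ∈ supportedIn D.coeff {g} ∧
      s - u ∈ supportedIn D.coeff ((D.coeff s).support \ {g}) := by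
  obtain ⟨c, hc, hsc⟩ := exists_sub_mem_supportedIn_diff (mem_supportedIn_support D.coeff s) g
  have hc0 : c ≠ 0 := by
    rintro rfl
    exact Finsupp.mem_support_iff.1 hg (by simpa using hsc g (by simp))
  obtain ⟨u, rfl, -⟩ := D.exists_unit hc hc0
  exact ⟨u, hc, hsc⟩

theorem noZeroDivisors (D : GradedDivisionRing F G S) [UniqueProds G] [Nontrivial S] :
    NoZeroDivisors S := by
  refine ⟨fun {a b} hab ↦ ?_⟩
  by_contra! hne
  obtain ⟨ha, hb⟩ := hne
  obtain ⟨g, hg, h, hh, hunique⟩ := UniqueProds.uniqueMul_of_nonempty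
    (A := (D.coeff a).support) (B := (D.coeff b).support) (by simpa using ha) (by simpa using hb)
  obtain ⟨u, hu, hau⟩ := D.exists_unit_sub_mem hg
  obtain ⟨v, hv, hbv⟩ := D.exists_unit_sub_mem hh
  have huv : (u * v : S) ∈ supportedIn D.coeff {g * h}ᶜ := by
    have heq : (u * v : S) = -((a - u) * b + u * (b - v)) := by
      calc (u * v : S) = a * b - ((a - u) * b + u * (b - v)) := by noncomm_ring
        _ = -((a - u) * b + u * (b - v)) := by rw [hab, zero_sub]
    rw [heq]
    refine neg_mem (add_mem
      (supportedIn_mono ?_ (D.mul_mem_supportedIn hau (mem_supportedIn_support D.coeff b)))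
      (supportedIn_mono ?_ (D.mul_mem_supportedIn hu hbv)))
    · rintro _ ⟨g', ⟨hg', hne⟩, h', hh', rfl⟩ heq'
      exact hne (hunique hg' hh' heq').1
    · rintro _ ⟨_, rfl, h', ⟨hh', hne⟩, rfl⟩ heq'
      exact hne (hunique hg hh' heq').2
  exact (u * v).ne_zero
    (eq_zero_of_mem_supportedIn_of_disjoint (D.mul_mem hu hv) huv disjoint_compl_right)

/-- The subring of the elements with support in the subgroup `H`. -/
def subring (H : Subgroup G) : Subring S where
  __ := supportedIn D.coeff H
  mul_mem' ha hb := by simpa using D.mul_mem_supportedIn ha hb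
  one_mem' := supportedIn_mono (by simp) D.one_mem

variable {D} in
theorem mem_subring {H : Subgroup G} {s : S} :
    s ∈ D.subring H ↔ s ∈ supportedIn D.coeff (H : Set G) := Iff.rfl

theorem isLeftOre_subring_bot [Nontrivial S] : IsLeftOre (D.subring ⊥) := by
  have exists_inv (a : D.subring ⊥) (ha : a ≠ 0) : ∃ c, c * a = 1 := by
    obtain ⟨u, hu, hu'⟩ := D.exists_unit (g := 1) a.2 (by simpa using ha)
    exact ⟨⟨↑u⁻¹, by simpa [mem_subring] using hu'⟩, Subtype.ext (by simp [← hu])⟩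
  intro a b ha hb
  obtain ⟨c, hc⟩ := exists_inv a ha
  obtain ⟨d, hd⟩ := exists_inv b hb
  exact ⟨c, d, hc.trans hd.symm, hc ▸ one_ne_zero⟩

theorem isLeftOre_subring_of_forall_finset {H : Subgroup G}
    (h : ∀ X : Finset G, (X : Set G) ⊆ H →
      ∃ K ≤ H, (X : Set G) ⊆ K ∧ IsLeftOre (D.subring K)) : IsLeftOre (D.subring H) := by
  classical
  rintro ⟨a, haH⟩ ⟨b, hbH⟩ ha hb
  obtain ⟨K, hKH, hXK, hK⟩ := h ((D.coeff a).support ∪ (D.coeff b).support)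
    (by
      rw [Finset.coe_union]
      exact Set.union_subset (mem_supportedIn_iff_support_subset.1 haH)
        (mem_supportedIn_iff_support_subset.1 hbH))
  rw [Finset.coe_union, Set.union_subset_iff] at hXK
  have haK : a ∈ D.subring K := supportedIn_mono hXK.1 (mem_supportedIn_support D.coeff a)
  have hbK : b ∈ D.subring K := supportedIn_mono hXK.2 (mem_supportedIn_support D.coeff b)
  have hle : D.subring K ≤ D.subring H := supportedIn_mono hKH
  exact hK.exists_mul_map_eq_mul_map (Subring.inclusion_injective hle) (a := ⟨a, haK⟩)
    (b := ⟨b, hbK⟩) ha hb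

section AbelianQuotient

variable {H : Subgroup G} {Q : Type*}

/-- The elements of `H` that `π` sends to `q`, as a subset of the ambient group. -/
def fibre (π : H → Q) (q : Q) : Set G := (↑) '' (π ⁻¹' {q})

theorem mem_fibre_apply (π : H → Q) (g : H) : (g : G) ∈ fibre π (π g) := ⟨g, rfl, rfl⟩

theorem pairwise_disjoint_fibre (π : H → Q) : Pairwise (Function.onFun Disjoint (fibre π)) :=
  fun _ _ hne ↦ (Set.disjoint_image_iff Subtype.val_injective).2
    ((Set.disjoint_singleton.2 hne).preimage π)

theorem subring_le_of_forall_fibre (π : H → Q) {P : AddSubgroup S}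
    (hP : ∀ q, supportedIn D.coeff (fibre π q) ≤ P) : (D.subring H).toAddSubgroup ≤ P :=
  supportedIn_le_iff.2 fun g hg _ hs ↦ hP (π ⟨g, hg⟩) <|
    supportedIn_mono (Set.singleton_subset_iff.2 (mem_fibre_apply π ⟨g, hg⟩)) hs

variable [Group Q] (π : H →* Q)

theorem fibre_one : fibre π 1 = (π.ker.map H.subtype : Set G) := rfl

theorem fibre_mul_fibre_subset (q r : Q) : fibre π q * fibre π r ⊆ fibre π (q * r) := by
  rintro _ ⟨_, ⟨g, rfl, rfl⟩, _, ⟨h, rfl, rfl⟩, rfl⟩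
  exact ⟨g * h, map_mul π g h, rfl⟩

theorem inv_mem_fibre {q : Q} {g : G} (hg : g ∈ fibre π q) : g⁻¹ ∈ fibre π q⁻¹ := by
  obtain ⟨g, rfl, rfl⟩ := hg
  exact ⟨g⁻¹, map_inv π g, rfl⟩

variable {π}

theorem exists_unit_mem_supportedIn_fibre [Nontrivial S] (hπ : Function.Surjective π) (q : Q) :
    ∃ u : Sˣ, ↑u ∈ supportedIn D.coeff (fibre π q) ∧ ↑u⁻¹ ∈ supportedIn D.coeff (fibre π q⁻¹) := by
  obtain ⟨g, rfl⟩ := hπ q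
  obtain ⟨u, hu, hu'⟩ := D.exists_unit_mem (g : G)
  have hg := mem_fibre_apply π g
  exact ⟨u, supportedIn_mono (by simpa using hg) hu,
    supportedIn_mono (by simpa using inv_mem_fibre π hg) hu'⟩

theorem mul_mem_supportedIn_fibre {q r : Q} {s t : S} (hs : s ∈ supportedIn D.coeff (fibre π q))
    (ht : t ∈ supportedIn D.coeff (fibre π r)) : s * t ∈ supportedIn D.coeff (fibre π (q * r)) :=
  supportedIn_mono (fibre_mul_fibre_subset π q r) (D.mul_mem_supportedIn hs ht)

theorem exists_mul_eq_of_mem_supportedIn_fibre {q : Q} {s : S} {u : Sˣ}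
    (hs : s ∈ supportedIn D.coeff (fibre π q)) (hu : ↑u⁻¹ ∈ supportedIn D.coeff (fibre π q⁻¹)) :
    ∃ a : D.subring (π.ker.map H.subtype), a * (u : S) = s := by
  have hmem := D.mul_mem_supportedIn_fibre hs hu
  rw [mul_inv_cancel, fibre_one] at hmem
  exact ⟨⟨_, hmem⟩, Units.inv_mul_cancel_right s u⟩

theorem subring_mul_mem_supportedIn_fibre (a : D.subring (π.ker.map H.subtype)) {q : Q} {s : S}
    (hs : s ∈ supportedIn D.coeff (fibre π q)) : a * s ∈ supportedIn D.coeff (fibre π q) := by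
  simpa only [one_mul] using D.mul_mem_supportedIn_fibre (q := 1) a.2 hs

theorem linearIndependent_of_mem_supportedIn_fibre {u : Q → Sˣ}
    (hu : ∀ q, ↑(u q) ∈ supportedIn D.coeff (fibre π q)) :
    LinearIndependent (D.subring (π.ker.map H.subtype)) fun q ↦ (u q : S) := by
  refine linearIndependent_iff'.2 fun t r hr q hq ↦ ?_
  have hzero := eq_zero_of_sum_eq_zero_of_pairwise_disjoint (pairwise_disjoint_fibre π)
    (fun q _ ↦ D.subring_mul_mem_supportedIn_fibre (r q) (hu q)) hr hq
  exact Subtype.ext ((u q).mul_left_eq_zero.1 hzero)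

end AbelianQuotient

theorem isLeftOre_subring_of_commGroup [IsDomain S] {H : Subgroup G} {Q : Type*} [CommGroup Q]
    {π : H →* Q} (hπ : Function.Surjective π)
    (hK : IsLeftOre (D.subring (π.ker.map H.subtype))) : IsLeftOre (D.subring H) := by
  set A := D.subring (π.ker.map H.subtype)
  have hKH : A ≤ D.subring H := supportedIn_mono (Subgroup.map_subtype_le _)
  have := hK.strongRankCondition
  let _ : Module A (D.subring H) := Module.compHom _ (Subring.inclusion hKH)
  have : IsScalarTower A (D.subring H) (D.subring H) :=
    ⟨fun a b c ↦ mul_assoc (Subring.inclusion hKH a) b c⟩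
  choose u hu hu' using D.exists_unit_mem_supportedIn_fibre hπ
  have fibre_le (q : Q) : supportedIn D.coeff (fibre π q) ≤ (D.subring H).toAddSubgroup :=
    supportedIn_mono (Subtype.coe_image_subset _ _)
  let e (q : Q) : D.subring H := ⟨u q, fibre_le q (hu q)⟩
  have mem_span {q : Q} {s : D.subring H} (hs : (s : S) ∈ supportedIn D.coeff (fibre π q)) :
      s ∈ Submodule.span A {e q} := by
    obtain ⟨a, ha⟩ := D.exists_mul_eq_of_mem_supportedIn_fibre hs (hu' q)
    exact Submodule.mem_span_singleton.2 ⟨a, Subtype.ext ha⟩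
  let incl : D.subring H →ₗ[A] S := { (D.subring H).subtype with map_smul' := fun _ _ ↦ rfl }
  have hli : LinearIndependent A e :=
    LinearIndependent.of_comp incl (D.linearIndependent_of_mem_supportedIn_fibre hu)
  have hspan : ⊤ ≤ Submodule.span A (Set.range e) := by
    rintro ⟨s, hs⟩ -
    have hle : (D.subring H).toAddSubgroup ≤
        ((Submodule.span A (Set.range e)).map incl).toAddSubgroup := by
      refine D.subring_le_of_forall_fibre π fun q t ht ↦ ?_
      exact ⟨⟨t, fibre_le q ht⟩,
        Submodule.span_mono (Set.singleton_subset_iff.2 (Set.mem_range_self q)) (mem_span ht), rfl⟩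
    obtain ⟨t, ht, rfl⟩ := hle hs
    exact ht
  refine isLeftOre_of_basis (Module.Basis.mk hli hspan) fun q r a ↦ ?_
  simp only [Module.Basis.mk_apply]
  exact mem_span (D.mul_mem_supportedIn_fibre (hu q)
    (D.subring_mul_mem_supportedIn_fibre a (hu r)))

end GradedDivisionRing

section Convex

variable {G : Type*} [Group G] [LinearOrder G]

theorem ConvexSubgroup.le_of_one_lt_of_notMem [MulLeftMono G] {C D : ConvexSubgroup G} {c : G}
    (hc : 1 < c) (hcC : c ∈ C.1) (hcD : c ∉ D.1) : D ≤ C := by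
  have mem_of_one_le {d : G} (hdD : d ∈ D.1) (hd : 1 ≤ d) : d ∈ C.1 := by
    have hdc : d ≤ c := le_of_not_ge fun hcd ↦ hcD (D.2.out D.1.one_mem hdD ⟨hc.le, hcd⟩)
    exact C.2.out C.1.one_mem hcC ⟨hd, hdc⟩
  intro d hdD
  rcases le_total 1 d with hd | hd
  · exact mem_of_one_le hdD hd
  · exact inv_mem_iff.1 (mem_of_one_le (inv_mem hdD) (Left.one_le_inv_iff.2 hd))

theorem ConvexSubgroup.le_total [MulLeftMono G] (C D : ConvexSubgroup G) : C ≤ D ∨ D ≤ C := by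
  refine or_iff_not_imp_left.2 fun hCD ↦ ?_
  obtain ⟨c, hcC, hcD⟩ := SetLike.not_le_iff_exists (p := C.1).1 hCD
  rcases lt_trichotomy c 1 with hc | rfl | hc
  · exact le_of_one_lt_of_notMem (Left.one_lt_inv_iff.2 hc) (inv_mem hcC) (by simpa using hcD)
  · exact (hcD D.1.one_mem).elim
  · exact le_of_one_lt_of_notMem hc hcC hcD

theorem ConvexSubgroup.eq_bot_of_isMin {C : ConvexSubgroup G} (hC : IsMin C) : C.1 = ⊥ := by
  have hbot : ((⊥ : Subgroup G) : Set G).OrdConnected := by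
    rw [Subgroup.coe_bot]
    exact Set.ordConnected_singleton
  have hle : (⟨⊥, hbot⟩ : ConvexSubgroup G) ≤ C := show ⊥ ≤ C.1 from bot_le
  exact le_bot_iff.1 (hC hle)

theorem ordConnected_iSup_of_directed {ι : Type*} [Nonempty ι] {C : ι → Subgroup G}
    (hdir : Directed (· ≤ ·) C) (hC : ∀ i, (C i : Set G).OrdConnected) :
    ((⨆ i, C i : Subgroup G) : Set G).OrdConnected := by
  refine ⟨fun x hx y hy z hz ↦ ?_⟩
  obtain ⟨i, hi⟩ := (Subgroup.mem_iSup_of_directed hdir).1 hx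
  obtain ⟨j, hj⟩ := (Subgroup.mem_iSup_of_directed hdir).1 hy
  obtain ⟨k, hik, hjk⟩ := hdir i j
  exact (Subgroup.mem_iSup_of_directed hdir).2 ⟨k, (hC k).out (hik hi) (hjk hj) hz⟩

theorem ConvexSubgroup.exists_finset_subset_of_isSuccLimit [MulLeftMono G] {C : ConvexSubgroup G}
    (hC : Order.IsSuccLimit C) {X : Finset G} (hX : (X : Set G) ⊆ C.1) :
    ∃ C' < C, (X : Set G) ⊆ C'.1 := by
  obtain ⟨B, hB⟩ := not_isMin_iff.1 hC.not_isMin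
  have : Nonempty (Set.Iio C) := ⟨⟨B, hB⟩⟩
  have hdir : Directed (· ≤ ·) fun D : Set.Iio C ↦ D.1.1 := fun D E ↦
    (le_total D.1 E.1).elim (fun h ↦ ⟨E, h, le_rfl⟩) (fun h ↦ ⟨D, le_rfl, h⟩)
  let V : ConvexSubgroup G := ⟨⨆ D : Set.Iio C, D.1.1,
    ordConnected_iSup_of_directed hdir fun D ↦ D.1.2⟩
  have hV (D : ConvexSubgroup G) (hD : D < C) : D ≤ V :=
    le_iSup (fun D : Set.Iio C ↦ D.1.1) ⟨D, hD⟩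
  have hVC : V = C := by
    have hle : V ≤ C := show V.1 ≤ C.1 from iSup_le fun D : Set.Iio C ↦ D.2.le
    refine hle.eq_of_not_lt fun hlt ↦ hC.isSuccPrelimit V ⟨hlt, fun D hVD hDC ↦ ?_⟩
    exact (hV D hDC).not_gt hVD
  rw [← hVC, Subgroup.coe_iSup_of_directed hdir] at hX
  obtain ⟨D, hD⟩ := Directed.exists_mem_subset_of_finset_subset_biUnion hdir hX
  exact ⟨D, D.2, hD⟩

namespace GradedDivisionRing

variable {F S : Type*} [AddCommGroup F] [Ring S] [MulLeftMono G]

theorem isLeftOre_subring_of_covBy [IsDomain S] (D : GradedDivisionRing F G S)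
    (hConrad : IsConradian G) {C' C : ConvexSubgroup G} (hcov : C' ⋖ C)
    (hC' : IsLeftOre (D.subring C'.1)) : IsLeftOre (D.subring C.1) := by
  obtain ⟨_, harch⟩ := hConrad C' C hcov
  have : MulLeftMono C.1 := ⟨fun c _ _ hab ↦ mul_le_mul_right (α := G) hab c⟩
  have hconvex : (C'.1.subgroupOf C.1 : Set C.1).OrdConnected :=
    ⟨fun _ ha _ hb _ hab ↦ C'.2.out ha hb hab⟩
  let _ : CommGroup (C.1 ⧸ C'.1.subgroupOf C.1) :=
    { QuotientGroup.Quotient.group _ with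
      mul_comm := commute_quotient_of_isArchimedeanOrder hconvex harch }
  refine D.isLeftOre_subring_of_commGroup
    (QuotientGroup.mk'_surjective (C'.1.subgroupOf C.1)) ?_
  rwa [QuotientGroup.ker_mk', Subgroup.map_subgroupOf_eq_of_le hcov.le]

theorem isLeftOre [IsDomain S] (D : GradedDivisionRing F G S) (hConrad : IsConradian G)
    [WellFoundedLT (ConvexSubgroup G)] : IsLeftOre S := by
  have isLeftOre_subring (C : ConvexSubgroup G) : IsLeftOre (D.subring C.1) := by
    induction C using WellFoundedLT.induction with
    | ind C ih =>
      by_cases hC : Order.IsSuccPrelimit C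
      · by_cases hmin : IsMin C
        · rw [ConvexSubgroup.eq_bot_of_isMin hmin]
          exact D.isLeftOre_subring_bot
        · refine D.isLeftOre_subring_of_forall_finset fun X hX ↦ ?_
          obtain ⟨C', hlt, hXC'⟩ :=
            ConvexSubgroup.exists_finset_subset_of_isSuccLimit ⟨hmin, hC⟩ hX
          exact ⟨C'.1, hlt.le, hXC', ih C' hlt⟩
      · obtain ⟨C', hcov⟩ := Order.not_isSuccPrelimit_iff.1 hC
        exact D.isLeftOre_subring_of_covBy hConrad hcov (ih C' hcov.lt)
  have htop := isLeftOre_subring ⟨⊤, by rw [Subgroup.coe_top]; exact Set.ordConnected_univ⟩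
  have mem_top (s : S) : s ∈ D.subring ⊤ := fun g hg ↦ (hg trivial).elim
  exact fun a b ↦ htop.exists_mul_map_eq_mul_map (D.subring ⊤).subtype_injective
    (a := ⟨a, mem_top a⟩) (b := ⟨b, mem_top b⟩)

end GradedDivisionRing

end Convex

namespace CrossedProduct

variable {A G S : Type*} [Ring A] [Group G] [Ring S] [Module A S] (P : CrossedProduct A G S)

theorem smul_x_mul_smul_x (a b : A) (g h : G) :
    (a • P.x g) * (b • P.x h) = (a * P.α g b * P.η g h) • P.x (g * h) := by
  calc (a • P.x g) * (b • P.x h)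
      = (a • P.x 1) * (((1 : A) • P.x g) * (b • P.x 1)) * ((1 : A) • P.x h) := by
        rw [← P.coeff_mul_x a, ← P.coeff_mul_x b]
        simp only [mul_assoc]
    _ = ((a • P.x 1) * (P.α g b • P.x 1)) * (((1 : A) • P.x g) * ((1 : A) • P.x h)) := by
        rw [P.x_mul_coeff, ← P.coeff_mul_x (P.α g b)]
        simp only [mul_assoc]
    _ = ((a * P.α g b) • P.x 1) * ((P.η g h : A) • P.x (g * h)) := by
        rw [P.coeff_mul_coeff, P.x_mul_x]
    _ = (a * P.α g b * P.η g h) • P.x (g * h) := by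
        rw [← P.coeff_mul_x (P.η g h : A), ← mul_assoc, P.coeff_mul_coeff, P.coeff_mul_x]

theorem mem_supportedIn_singleton {g : G} {s : S} :
    s ∈ supportedIn P.x.repr.toAddEquiv {g} ↔ ∃ a : A, a • P.x g = s := by
  constructor
  · intro hs
    refine ⟨P.x.repr s g, P.x.repr.injective ?_⟩
    ext h
    rcases eq_or_ne h g with rfl | hne
    · simp
    · simpa [hne] using (hs h hne).symm
  · rintro ⟨a, rfl⟩ h hne
    simpa using Finsupp.single_eq_of_ne hne

variable {F : Type*} [DivisionRing F] [Module F S] (R : CrossedProduct F G S)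

theorem exists_unit_eq_smul_x {a : F} (ha : a ≠ 0) (g : G) :
    ∃ (u : Sˣ) (b : F), ↑u = a • R.x g ∧ ↑u⁻¹ = b • R.x g⁻¹ := by
  let b : F := (R.α g⁻¹ a * R.η g⁻¹ g)⁻¹
  let c : F := (R.α g).symm (a⁻¹ * (R.η g g⁻¹ : F)⁻¹)
  have hleft : (b • R.x g⁻¹) * (a • R.x g) = 1 := by
    rw [R.smul_x_mul_smul_x, inv_mul_cancel, mul_assoc, inv_mul_cancel₀, R.one_smul_x_one]
    exact mul_ne_zero (by simpa using ha) (Units.ne_zero _)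
  have hright : (a • R.x g) * (c • R.x g⁻¹) = 1 := by
    rw [R.smul_x_mul_smul_x, mul_inv_cancel, RingEquiv.apply_symm_apply, mul_inv_cancel_left₀ ha,
      inv_mul_cancel₀ (Units.ne_zero _), R.one_smul_x_one]
  have heq := left_inv_eq_right_inv hleft hright
  exact ⟨⟨a • R.x g, b • R.x g⁻¹, heq ▸ hright, hleft⟩, b, rfl, rfl⟩

/-- A crossed product over a skew field, graded by the basis `x_g`. -/
noncomputable def gradedDivisionRing : GradedDivisionRing F G S where
  coeff := R.x.repr.toAddEquiv
  one_mem := R.mem_supportedIn_singleton.2 ⟨1, R.one_smul_x_one⟩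
  mul_mem hs ht := by
    obtain ⟨a, rfl⟩ := R.mem_supportedIn_singleton.1 hs
    obtain ⟨b, rfl⟩ := R.mem_supportedIn_singleton.1 ht
    exact R.mem_supportedIn_singleton.2 ⟨_, (R.smul_x_mul_smul_x a b _ _).symm⟩
  exists_unit {g _} hs hs0 := by
    obtain ⟨a, rfl⟩ := R.mem_supportedIn_singleton.1 hs
    obtain ⟨u, b, hu, hu'⟩ := R.exists_unit_eq_smul_x (left_ne_zero_of_smul hs0) g
    exact ⟨u, hu, R.mem_supportedIn_singleton.2 ⟨b, hu'.symm⟩⟩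

end CrossedProduct

end ConradOre

theorem mainTheorem10 {F G S : Type*} [DivisionRing F] [Group G] [Ring S] [Module F S]
    (R : ConradOre.CrossedProduct F G S)
    [LinearOrder G] [MulLeftMono G] (hConrad : ConradOre.IsConradian G)
    (hwo : IsWellOrder (ConradOre.ConvexSubgroup G) (· < ·)) :
    ConradOre.IsOreDomain S := by
  have : Nontrivial S := ⟨R.x 1, 0, R.x.ne_zero 1⟩
  have := R.gradedDivisionRing.noZeroDivisors
  have hdomain : IsDomain S := NoZeroDivisors.to_isDomain S
  have : WellFoundedLT (ConradOre.ConvexSubgroup G) := hwo.toIsWellFounded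
  refine ⟨hdomain, R.gradedDivisionRing.isLeftOre hConrad, fun a b ha hb ↦ ?_⟩
  obtain ⟨c, d, heq, hne⟩ := R.gradedDivisionRing.op.isLeftOre hConrad (MulOpposite.op a)
    (MulOpposite.op b) (by simpa using ha) (by simpa using hb)
  exact ⟨c.unop, d.unop, congrArg MulOpposite.unop heq,
    fun h ↦ hne (MulOpposite.unop_injective h)⟩
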